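/- Let $\mathcal{M}=(V,\mathcal{I})$ be a matroid on a finite ground set $V$, of rank $k$, with weights $\omega:V\to\mathbb{R}$, and let $t,\tau\ge 0$ be integers. Call $S\subseteq V$ independent in the union $\tau\mathcal{M}=(V,\mathcal{I}_\tau)$ if $S$ is the disjoint union of $\tau$ (possibly empty) sets $S_1,\dots,S_\tau\in\mathcal{I}$. Construct $V'\subseteq V$ greedily: start with $V'=\emptyset$, process the elements of $V$ one by one in an order of non-increasing weight $\omega$ (ties broken arbitrarily), and for each element $u$ add $u$ to $V'$ if $V'\cup\{u\}\in\mathcal{I}_\tau$, and ignore $u$ otherwise. Say that $V'$ is $t$-robust if for every base $O$ of $\mathcal{M}$ there are sets $U_u\subseteq V'\setminus O$, one for each $u\in O\setminus V'$, such that 1. the sets $U_u$ are pairwise disjoint and $|U_u|=t$ for all $u\in O\setminus V'$; 2. $\omega(v)\ge\omega(u)$ for all $u\in O\setminus V'$ and all $v\in U_u$; 3. for every choice of one element $u'\in U_u$ for each $u\in O\setminus V'$, the set $(V'\cap O)\cup\{u' : u\in O\setminus V'\}$ is a base of $\mathcal{M}$. Then the final set $V'$ is $t$-robust in each of the following cases: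 * (i) $\mathcal{M}$ is a partition matroid and $\tau\ge t$. That is, there are a partition $V_1,\dots,V_r$ of $V$ and bounds $k_1,\dots,k_r\in\mathbb{Z}_{\ge0}$ such that $S\subseteq V$ is independent iff $|S\cap V_i|\le k_i$ for all $i$. * (ii) $\mathcal{M}$ is a laminar matroid and $\tau\ge 2t$. That is, there are a family $V_1,\dots,V_r\subseteq V$, any two members of which are disjoint or nested, and bounds $k_1,\dots,k_r\in\mathbb{Z}_{\ge0}$ such that $S\subseteq V$ is independent iff $|S\cap V_i|\le k_i$ for all $i$. * (iii) $\mathcal{M}$ is a transversal matroid and $\tau\ge t+k-1$. That is, there are sets $V_1,\dots,V_m\subseteq V$ such that $S\subseteq V$ is independent iff there is an injective map $\phi:S\to\{1,\dots,m\}$ with $u\in V_{\phi(u)}$ for all $u\in S$. -/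

import Mathlib

namespace GreedyUnion

/-- `M` is a partition matroid: there are a partition `A 0, …, A (r-1)` of the ground set and
bounds `b i` such that the independent sets are the `S ⊆ M.E` with `|S ∩ A i| ≤ b i` for all `i`. -/
def IsPartitionMatroid {α : Type*} (M : Matroid α) : Prop :=
  ∃ (r : ℕ) (A : Fin r → Set α) (b : Fin r → ℕ),
    (∀ i j, i ≠ j → Disjoint (A i) (A j)) ∧ (⋃ i, A i) = M.E ∧
    ∀ S : Set α, M.Indep S ↔ S ⊆ M.E ∧ ∀ i, (S ∩ A i).encard ≤ b i

/-- `M` is a laminar matroid: there are a laminar family `A 0, …, A (r-1)` of subsets of the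
ground set (any two members are disjoint or nested) and bounds `b i` such that the independent
sets are the `S ⊆ M.E` with `|S ∩ A i| ≤ b i` for all `i`. -/
def IsLaminarMatroid {α : Type*} (M : Matroid α) : Prop :=
  ∃ (r : ℕ) (A : Fin r → Set α) (b : Fin r → ℕ),
    (∀ i, A i ⊆ M.E) ∧
    (∀ i j, Disjoint (A i) (A j) ∨ A i ⊆ A j ∨ A j ⊆ A i) ∧
    ∀ S : Set α, M.Indep S ↔ S ⊆ M.E ∧ ∀ i, (S ∩ A i).encard ≤ b i

/-- `M` is a transversal matroid: there are subsets `A 0, …, A (m-1)` of the ground set such that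
`S ⊆ M.E` is independent iff its elements `u` can be assigned distinct indices `φ u`
with `u ∈ A (φ u)`. -/
def IsTransversalMatroid {α : Type*} (M : Matroid α) : Prop :=
  ∃ (m : ℕ) (A : Fin m → Set α),
    (∀ i, A i ⊆ M.E) ∧
    ∀ S : Set α, M.Indep S ↔
      S ⊆ M.E ∧ ∃ φ : S → Fin m, Function.Injective φ ∧ ∀ u : S, (u : α) ∈ A (φ u)

/-- Independence in the matroid union `τ M` of `τ` copies of `M`: `S` splits into `τ` pairwise
disjoint (possibly empty) sets, each independent in `M`. -/
def UnionIndep {α : Type*} (M : Matroid α) (τ : ℕ) (S : Set α) : Prop :=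
  ∃ P : Fin τ → Set α,
    (∀ i, M.Indep (P i)) ∧ (∀ i j, i ≠ j → Disjoint (P i) (P j)) ∧ (⋃ i, P i) = S

open Classical in
/-- One step of the greedy procedure on `τ M`: add `u` to the current set if the result is
independent in `τ M`, and ignore `u` otherwise. -/
noncomputable def greedyStep {α : Type*} (M : Matroid α) (τ : ℕ) (S : Set α) (u : α) : Set α :=
  if UnionIndep M τ (insert u S) then insert u S else S

/-- The output of the greedy procedure on `τ M`, started with `∅` and processing the elements
in the order of the list `l`. -/
noncomputable def greedy {α : Type*} (M : Matroid α) (τ : ℕ) (l : List α) : Set α :=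
  l.foldl (greedyStep M τ) ∅

/-- `l` lists every element of the ground set of `M` exactly once, by non-increasing weight
(ties are broken arbitrarily). -/
def IsGreedyOrder {α : Type*} (M : Matroid α) (ω : α → ℝ) (l : List α) : Prop :=
  l.Nodup ∧ (∀ v, v ∈ l ↔ v ∈ M.E) ∧ l.Pairwise (fun u v => ω v ≤ ω u)

/-- `V'` is `t`-robust in the matroid `M` with weights `ω`. -/
def IsRobust {α : Type*} (M : Matroid α) (ω : α → ℝ) (t : ℕ) (V' : Set α) : Prop :=
  V' ⊆ M.E ∧
  ∀ O : Set α, M.IsBase O → ∃ U : α → Set α,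
    (∀ u ∈ O \ V', U u ⊆ V' \ O) ∧
    (∀ u ∈ O \ V', ∀ v ∈ O \ V', u ≠ v → Disjoint (U u) (U v)) ∧
    (∀ u ∈ O \ V', (U u).encard = t) ∧
    (∀ u ∈ O \ V', ∀ v ∈ U u, ω u ≤ ω v) ∧
    ∀ f : α → α, (∀ u ∈ O \ V', f u ∈ U u) → M.IsBase ((V' ∩ O) ∪ f '' (O \ V'))

end GreedyUnion

/-! If the greedy procedure rejects `u`, then `u` cannot be added to the set `G` of elements chosen
so far, all at least as heavy as `u` (`exists_of_notMem_greedy`). In each case this obstruction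
yields many elements of `G` that can stand in for `u`. Since a replacement has the cardinality of
the base, only its independence has to be checked.

Laminar families: a set is independent in the union iff it has at most `τ * b i` elements in each `A
i`. For sufficiency, number the set so that each `A i` occupies an interval and colour by residues
mod `τ`. Hence a rejected `u` lies in a tight member, filled with heavier elements
(`exists_tight_of_notMem_greedy`). For a partition, counting then leaves room for disjoint `t`-sets
in each class. For a laminar family a block may meet several members, so blocks are built from the
bottom up (`Packing`): at most `b i` of them meet `A i`, leftovers smaller than `t` are merged, and
a merged block has fewer than `2 * t ≤ τ` elements. Thus a tight member contains enough blocks for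
all its elements of `O`.

Transversal matroids: the union is a matching problem with slots `Fin m × Fin τ`. By Hall's theorem
a rejected `u` finds all its slots occupied, in particular the `τ` copies of the index `φ u` matched
to it in `O`. At most `k - 1` occupants lie in `O`, so `t` others remain, and each of them can take
over `φ u`. -/

namespace GreedyUnion

open Finset

/-! ### Combinatorics of laminar families -/

section Laminar

variable {ι α : Type*} [DecidableEq ι] [DecidableEq α]

/-- Induction along a laminar family: a property of pairs (subfamily, set containing all its
members) holds as soon as it holds for the empty subfamily of a set with at most one element, and
is preserved by disjoint unions and by adding the whole set to the subfamily. -/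
theorem laminar_induction (A : ι → Finset α)
    (hA : ∀ i j, Disjoint (A i) (A j) ∨ A i ⊆ A j ∨ A j ⊆ A i)
    {C : Finset ι → Finset α → Prop} (empty : C ∅ ∅) (single : ∀ x, C ∅ {x})
    (union : ∀ s₁ s₂ Z₁ Z₂, Disjoint Z₁ Z₂ → (∀ i ∈ s₁, A i ⊆ Z₁) → (∀ i ∈ s₂, A i ⊆ Z₂) →
      C s₁ Z₁ → C s₂ Z₂ → C (s₁ ∪ s₂) (Z₁ ∪ Z₂))
    (insert : ∀ s i, (∀ j ∈ s, A j ⊆ A i) → C s (A i) → C (insert i s) (A i)) :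
    ∀ s Z, (∀ i ∈ s, A i ⊆ Z) → C s Z := by
  -- Neither cardinality alone decreases: removing an index keeps `Z`, and splitting off an empty
  -- member keeps it too.
  suffices h : ∀ n s Z, #Z + #s = n → (∀ i ∈ s, A i ⊆ Z) → C s Z from
    fun s Z => h _ s Z rfl
  intro n
  induction n using Nat.strong_induction_on with
  | _ n ih =>
  rintro s Z rfl hs
  by_cases hZ : ∃ i ∈ s, A i = Z
  · obtain ⟨i, hi, rfl⟩ := hZ
    have hlt := card_erase_lt_of_mem hi
    have h := ih _ (by omega) (s.erase i) (A i) rfl fun j hj => hs j (mem_of_mem_erase hj)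
    rw [← insert_erase hi]
    exact insert _ _ (fun j hj => hs j (mem_of_mem_erase hj)) h
  push Not at hZ
  rcases s.eq_empty_or_nonempty with rfl | hne
  · rcases Z.eq_empty_or_nonempty with rfl | ⟨x, hx⟩
    · exact empty
    · have hlt := card_erase_lt_of_mem hx
      have h := union ∅ ∅ {x} (Z.erase x) (by simp) (by simp) (by simp) (single x)
        (ih _ (by omega) ∅ _ rfl (by simp))
      rwa [union_empty, ← insert_eq, insert_erase hx] at h
  -- A largest member is proper in `Z`, and by laminarity every other member lies inside it or is
  -- disjoint from it, so `Z` splits.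
  · obtain ⟨i, hi, hmax⟩ := s.exists_max_image (fun i => #(A i)) hne
    have hlt : #(A i) < #Z := card_lt_card ((hs i hi).ssubset_of_ne (hZ i hi))
    have h₁ : C (s.filter fun j => A j ⊆ A i) (A i) := by
      have := card_filter_le s fun j => A j ⊆ A i
      exact ih _ (by omega) _ _ rfl fun j hj => (mem_filter.1 hj).2
    have hsub : ∀ j ∈ s.filter (fun j => ¬ A j ⊆ A i), A j ⊆ Z \ A i := by
      intro j hj
      obtain ⟨hj, hji⟩ := mem_filter.1 hj
      rcases hA j i with h | h | h
      · exact subset_sdiff.2 ⟨hs j hj, h⟩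
      · exact absurd h hji
      · exact absurd (eq_of_subset_of_card_le h (hmax j hj)).ge hji
    have h₂ : C (s.filter fun j => ¬ A j ⊆ A i) (Z \ A i) := by
      have h₃ : #(s.filter fun j => ¬ A j ⊆ A i) < #s :=
        card_lt_card (filter_ssubset.2 ⟨i, hi, by simp⟩)
      have h₄ := card_le_card (sdiff_subset : Z \ A i ⊆ Z)
      exact ih _ (by omega) _ _ rfl hsub
    have h := union _ _ _ _ disjoint_sdiff (fun j hj => (mem_filter.1 hj).2) hsub h₁ h₂
    rwa [filter_union_filter_not_eq, union_sdiff_of_subset (hs i hi)] at h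

/-- The elements of a finite set can be numbered so that every member of a laminar family occupies
an interval. -/
theorem exists_laminar_numbering (A : ι → Finset α)
    (hA : ∀ i j, Disjoint (A i) (A j) ∨ A i ⊆ A j ∨ A j ⊆ A i) (S : Finset α)
    (s : Finset ι) (Z : Finset α) (hs : ∀ i ∈ s, A i ⊆ Z) :
    ∃ pos : α → ℕ, (∀ x ∈ S ∩ Z, pos x < #(S ∩ Z)) ∧ Set.InjOn pos ↑(S ∩ Z) ∧
      ∀ i ∈ s, ∃ p, ∀ x ∈ S ∩ A i, p ≤ pos x ∧ pos x < p + #(S ∩ A i) := by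
  refine laminar_induction A hA (C := fun s Z => ∃ pos : α → ℕ, (∀ x ∈ S ∩ Z, pos x < #(S ∩ Z)) ∧
    Set.InjOn pos ↑(S ∩ Z) ∧
      ∀ i ∈ s, ∃ p, ∀ x ∈ S ∩ A i, p ≤ pos x ∧ pos x < p + #(S ∩ A i)) ?_ ?_ ?_ ?_ s Z hs
  · exact ⟨fun _ => 0, by simp, by simp, by simp⟩
  · intro x
    refine ⟨fun _ => 0, fun y hy => card_pos.2 ⟨y, hy⟩, ?_, by simp⟩
    intro y hy z hz _
    simp only [coe_inter, coe_singleton, Set.mem_inter_iff, Set.mem_singleton_iff] at hy hz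
    rw [hy.2, hz.2]
  · rintro s₁ s₂ Z₁ Z₂ hd h₁ h₂ ⟨f, hf, hfi, hfA⟩ ⟨g, hg, hgi, hgA⟩
    have hnot : ∀ x ∈ Z₂, x ∉ Z₁ := fun x hx hx' => disjoint_left.1 hd hx' hx
    have hcard : #(S ∩ (Z₁ ∪ Z₂)) = #(S ∩ Z₁) + #(S ∩ Z₂) := by
      rw [inter_union_distrib_left, card_union_of_disjoint]
      exact hd.mono inter_subset_right inter_subset_right
    refine ⟨fun x => if x ∈ Z₁ then f x else #(S ∩ Z₁) + g x, ?_, ?_, ?_⟩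
    · intro x hx
      rw [hcard]
      obtain ⟨hxS, hx⟩ := mem_inter.1 hx
      rcases mem_union.1 hx with hx | hx
      · have := hf x (mem_inter.2 ⟨hxS, hx⟩)
        simp only [hx, if_true]; omega
      · have := hg x (mem_inter.2 ⟨hxS, hx⟩)
        simp only [hnot x hx, if_false]; omega
    · intro x hx y hy hxy
      obtain ⟨hxS, hx⟩ := mem_inter.1 (mem_coe.1 hx)
      obtain ⟨hyS, hy⟩ := mem_inter.1 (mem_coe.1 hy)
      rcases mem_union.1 hx with hx | hx <;> rcases mem_union.1 hy with hy | hy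
      · simp only [hx, hy, if_true] at hxy
        exact hfi (by simp [hxS, hx]) (by simp [hyS, hy]) hxy
      · simp only [hx, hnot y hy, if_true, if_false] at hxy
        have := hf x (mem_inter.2 ⟨hxS, hx⟩)
        omega
      · simp only [hy, hnot x hx, if_true, if_false] at hxy
        have := hf y (mem_inter.2 ⟨hyS, hy⟩)
        omega
      · simp only [hnot x hx, hnot y hy, if_false] at hxy
        exact hgi (by simp [hxS, hx]) (by simp [hyS, hy]) (by omega)
    · intro i hi
      rcases mem_union.1 hi with hi | hi
      · obtain ⟨p, hp⟩ := hfA i hi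
        refine ⟨p, fun x hx => ?_⟩
        simpa only [h₁ i hi (mem_inter.1 hx).2, if_true] using hp x hx
      · obtain ⟨p, hp⟩ := hgA i hi
        refine ⟨#(S ∩ Z₁) + p, fun x hx => ?_⟩
        have := hp x hx
        simp only [hnot x (h₂ i hi (mem_inter.1 hx).2), if_false]
        omega
  · rintro s i - ⟨f, hf, hfi, hfA⟩
    refine ⟨f, hf, hfi, fun j hj => ?_⟩
    rcases mem_insert.1 hj with rfl | hj
    · exact ⟨0, fun x hx => ⟨Nat.zero_le _, by simpa using hf x hx⟩⟩
    · exact hfA j hj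

/-- If a finite set meets every member `A i` of a laminar family in at most `τ * b i` elements, it
can be coloured with `τ` colours so that every colour occurs at most `b i` times in `A i`. -/
theorem exists_laminar_coloring [Fintype ι] (A : ι → Finset α)
    (hA : ∀ i j, Disjoint (A i) (A j) ∨ A i ⊆ A j ∨ A j ⊆ A i) (S : Finset α) {τ : ℕ}
    (hτ : 0 < τ) (b : ι → ℕ) (hb : ∀ i, #(S ∩ A i) ≤ τ * b i) :
    ∃ c : α → Fin τ, ∀ i k, #{x ∈ S ∩ A i | c x = k} ≤ b i := by
  obtain ⟨pos, -, hinj, hint⟩ := exists_laminar_numbering A hA S univ (univ.biUnion A)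
    fun i _ => subset_biUnion_of_mem A (mem_univ i)
  refine ⟨fun x => ⟨pos x % τ, Nat.mod_lt _ hτ⟩, fun i k => ?_⟩
  obtain ⟨p, hp⟩ := hint i (mem_univ i)
  rw [← card_range (b i)]
  -- An interval of at most `τ * b i` positions has at most `b i` in any residue class; the quotient
  -- tells them apart.
  refine card_le_card_of_injOn (fun x => (pos x - p) / τ) ?_ ?_
  · intro x hx
    have := hp x (mem_filter.1 hx).1
    have := hb i
    simp only [coe_range, Set.mem_Iio]
    rw [Nat.div_lt_iff_lt_mul hτ, mul_comm]
    omega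
  · intro x hx y hy hxy
    obtain ⟨hx, hxk⟩ := mem_filter.1 (mem_coe.1 hx)
    obtain ⟨hy, hyk⟩ := mem_filter.1 (mem_coe.1 hy)
    have hxp := hp x hx
    have hyp := hp y hy
    have hmod : pos x % τ = pos y % τ := by
      rw [← hyk] at hxk
      simpa using hxk
    have hmod' : (pos x - p) % τ = (pos y - p) % τ := by
      have : pos x ≡ pos y [MOD τ] := hmod
      have h : (pos x - p) + p ≡ (pos y - p) + p [MOD τ] := by
        rwa [Nat.sub_add_cancel hxp.1, Nat.sub_add_cancel hyp.1]
      exact Nat.ModEq.add_right_cancel' p h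
    have heq : pos x - p = pos y - p := by
      rw [← Nat.div_add_mod (pos x - p) τ, ← Nat.div_add_mod (pos y - p) τ, hmod']
      simp only at hxy
      rw [hxy]
    have hmem : ∀ z ∈ S ∩ A i, z ∈ (↑(S ∩ univ.biUnion A) : Set α) := fun z hz => by
      rw [mem_coe]
      exact inter_subset_inter_left (subset_biUnion_of_mem A (mem_univ i)) hz
    exact hinj (hmem x hx) (hmem y hy) (by omega)

end Laminar

/-! ### Packing blocks into a laminar family -/

section Packing

variable {ι α : Type*} [DecidableEq α]

/-- An injection between finite sets extends to any larger domain that is not larger than the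
codomain. -/
theorem exists_injOn_extension {β : Type*} [DecidableEq β] {T T' : Finset α} {P : Finset β}
    (hT : T ⊆ T') (hcard : #T' ≤ #P) {g : α → β} (hg : ∀ u ∈ T, g u ∈ P)
    (hinj : Set.InjOn g ↑T) :
    ∃ g' : α → β, (∀ u ∈ T, g' u = g u) ∧ (∀ u ∈ T', g' u ∈ P) ∧ Set.InjOn g' ↑T' := by
  induction hn : #(T' \ T) generalizing T g with
  | zero =>
    have hsub : T' ⊆ T := sdiff_eq_empty_iff_subset.1 (card_eq_zero.1 hn)
    exact ⟨g, fun _ _ => rfl, fun u hu => hg u (hsub hu), hinj.mono (coe_subset.2 hsub)⟩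
  | succ n ih =>
    obtain ⟨x, hx⟩ : (T' \ T).Nonempty := card_pos.1 (by omega)
    obtain ⟨hx', hxT⟩ := mem_sdiff.1 hx
    obtain ⟨p, hp, hpg⟩ : ∃ p ∈ P, p ∉ T.image g := by
      refine exists_mem_notMem_of_card_lt_card ((card_image_le).trans_lt ?_)
      exact (card_lt_card ⟨hT, fun h => hxT (h hx')⟩).trans_le hcard
    have hne : ∀ u ∈ T, Function.update g x p u = g u := fun u hu =>
      Function.update_of_ne (ne_of_mem_of_not_mem hu hxT) _ _
    obtain ⟨g', h₁, h₂, h₃⟩ := ih (T := insert x T) (g := Function.update g x p)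
      (insert_subset hx' hT) (by
        intro u hu
        rcases mem_insert.1 hu with rfl | hu
        · simpa using hp
        · rw [hne u hu]; exact hg u hu) (by
        rw [coe_insert, Set.injOn_insert (by simpa using hxT)]
        refine ⟨hinj.congr fun u hu => (hne u hu).symm, ?_⟩
        rintro ⟨u, hu, hux⟩
        rw [hne u hu, Function.update_self] at hux
        exact hpg (mem_image.2 ⟨u, hu, hux⟩)) (by
        have := card_erase_of_mem hx
        rw [sdiff_insert]; omega)
    exact ⟨g', fun u hu => by rw [h₁ u (mem_insert_of_mem hu), hne u hu], h₂, h₃⟩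

/-- A partial packing of blocks into a set `X`, relative to a laminar family `A` with bounds `b`.
Only members of the subfamily `s` and elements of `Z` are taken into account. The set `P` consists
of disjoint blocks, which are singletons of elements of `O` or sets of at least `t` elements
outside `O`; the remainder `q` has fewer than `m` elements. The map `g` assigns distinct blocks to
the elements of `O ∩ X`, and to those `u ∈ O \ X` for which `β u` is in the subfamily. -/
structure Packing (X O : Finset α) (A : ι → Finset α) (b : ι → ℕ) (β : α → ι) (t τ m : ℕ)
    (s : Finset ι) (Z : Finset α) (P : Finset (Finset α)) (q : Finset α) (g : α → Finset α) :
    Prop where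
  rem_subset : q ⊆ (X \ O) ∩ Z
  rem_card : #q < m
  subset : ∀ p ∈ P, p ⊆ X ∩ Z
  block : ∀ p ∈ P, (∃ y ∈ O, p = {y}) ∨ (p ⊆ X \ O ∧ t ≤ #p)
  disj : ∀ p ∈ P, ∀ p' ∈ P, p ≠ p' → Disjoint p p'
  rem_disj : ∀ p ∈ P, Disjoint p q
  card_le : #(X ∩ Z) ≤ τ * #P + #q
  meet_le : ∀ i ∈ s, #{p ∈ P | (p ∩ A i).Nonempty} + (if (q ∩ A i).Nonempty then 1 else 0) ≤ b i
  map_mem : ∀ u ∈ O ∩ Z, u ∈ X ∨ β u ∈ s → g u ∈ P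
  map_inj : Set.InjOn g {u | u ∈ O ∩ Z ∧ (u ∈ X ∨ β u ∈ s)}
  map_self : ∀ u ∈ O ∩ Z, u ∈ X → g u = {u}
  map_subset : ∀ u ∈ O ∩ Z, u ∉ X → β u ∈ s → g u ⊆ A (β u)

variable {X O : Finset α} {A : ι → Finset α} {b : ι → ℕ} {β : α → ι} {t τ m : ℕ}
  {s s₁ s₂ : Finset ι} {Z Z₁ Z₂ : Finset α} {P P₁ P₂ : Finset (Finset α)} {q q₁ q₂ : Finset α}
  {g g₁ g₂ : α → Finset α}

theorem Packing.nonempty (h : Packing X O A b β t τ m s Z P q g) (ht : 0 < t) {p : Finset α}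
    (hp : p ∈ P) : p.Nonempty := by
  rcases h.block p hp with ⟨y, -, rfl⟩ | h
  · exact singleton_nonempty y
  · exact card_pos.1 (ht.trans_le h.2)

/-- A remainder of between `t` and `2t - 1` elements is turned into a block. -/
theorem Packing.normalize (h : Packing X O A b β t τ (2 * t) s Z P q g) (ht : 0 < t)
    (hτ : 2 * t ≤ τ) : ∃ P q, Packing X O A b β t τ t s Z P q g := by
  by_cases hq : #q < t
  · exact ⟨P, q, { h with rem_card := hq }⟩
  push Not at hq
  have hne : q.Nonempty := card_pos.1 (ht.trans_le hq)
  have hqP : q ∉ P := fun hqP => hne.ne_empty (disjoint_self.1 (h.rem_disj q hqP))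
  refine ⟨insert q P, ∅, { h with
    rem_subset := empty_subset _
    rem_card := by simpa using ht
    subset := ?_
    block := ?_
    disj := ?_
    rem_disj := by simp
    card_le := ?_
    meet_le := ?_
    map_mem := fun u hu hu' => mem_insert_of_mem (h.map_mem u hu hu') }⟩
  · intro p hp
    rcases mem_insert.1 hp with rfl | hp
    · exact h.rem_subset.trans (inter_subset_inter_right sdiff_subset)
    · exact h.subset p hp
  · intro p hp
    rcases mem_insert.1 hp with rfl | hp
    · exact Or.inr ⟨h.rem_subset.trans inter_subset_left, hq⟩
    · exact h.block p hp
  · intro p hp p' hp' hpp'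
    rcases mem_insert.1 hp with hp | hp <;> rcases mem_insert.1 hp' with hp' | hp'
    · exact absurd (hp.trans hp'.symm) hpp'
    · exact hp ▸ (h.rem_disj p' hp').symm
    · exact hp' ▸ h.rem_disj p hp
    · exact h.disj p hp p' hp' hpp'
  · have := h.card_le
    have := h.rem_card
    -- The new block pays for its elements, since `#q < 2 * t ≤ τ`.
    rw [card_insert_of_notMem hqP, mul_add]
    omega
  · intro i hi
    have := h.meet_le i hi
    rw [filter_insert]
    split_ifs with h₁ h₂
    · simp at h₂
    · rw [if_pos h₁] at this
      exact (card_insert_le _ _).trans this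
    · simp_all
    · rw [if_neg h₁] at this
      exact this

theorem Packing.exists_empty (ht : 0 < t) : 
    ∃ P q g, Packing X O A b β t τ t ∅ ∅ P q g :=
  ⟨∅, ∅, fun _ => ∅, by constructor <;> simp [ht]⟩

theorem Packing.exists_singleton (ht : 0 < t) (hτ : 2 * t ≤ τ) (x : α) :
    ∃ P q g, Packing X O A b β t τ t ∅ {x} P q g := by
  by_cases hX : x ∈ X
  · by_cases hO : x ∈ O
    · refine ⟨{{x}}, ∅, fun _ => {x}, ?_⟩
      constructor <;> simp [ht, hX, hO]
      · omega
      · exact fun u hu v hv _ => hu.1.trans hv.1.symm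
    -- An element outside `O` starts as a remainder; normalizing makes it a block when `t = 1`.
    · have h : Packing X O A b β t τ (2 * t) ∅ {x} ∅ {x} fun _ => {x} := by
        constructor <;> simp [hX, hO]
        · omega
      obtain ⟨P, q, h⟩ := h.normalize ht hτ
      exact ⟨P, q, _, h⟩
  · refine ⟨∅, ∅, fun _ => ∅, ?_⟩
    constructor <;> simp [ht, hX]
    · exact fun u _ h => h ▸ hX
    · exact fun u hu => absurd (hu.1.2 ▸ hu.2) hX
    · exact fun u _ h => h ▸ hX

/-- Blocks are kept and the two remainders merged. A member on one side is met by nothing from the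
other, so merging does not raise its count, and the merged remainder is below `2 * t`, small enough
to become one block. -/
theorem Packing.union [DecidableEq ι] (h₁ : Packing X O A b β t τ t s₁ Z₁ P₁ q₁ g₁)
    (h₂ : Packing X O A b β t τ t s₂ Z₂ P₂ q₂ g₂) (ht : 0 < t) (hτ : 2 * t ≤ τ)
    (hβ : ∀ u ∈ O \ X, u ∈ A (β u)) (hd : Disjoint Z₁ Z₂)
    (hs₁ : ∀ i ∈ s₁, A i ⊆ Z₁) (hs₂ : ∀ i ∈ s₂, A i ⊆ Z₂) :
    ∃ P q g, Packing X O A b β t τ t (s₁ ∪ s₂) (Z₁ ∪ Z₂) P q g := by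
  have hZ₁ : ∀ p ∈ P₁, p ⊆ Z₁ := fun p hp => (h₁.subset p hp).trans inter_subset_right
  have hZ₂ : ∀ p ∈ P₂, p ⊆ Z₂ := fun p hp => (h₂.subset p hp).trans inter_subset_right
  have hq₁ : q₁ ⊆ Z₁ := h₁.rem_subset.trans inter_subset_right
  have hq₂ : q₂ ⊆ Z₂ := h₂.rem_subset.trans inter_subset_right
  have hP : Disjoint P₁ P₂ := disjoint_left.2 fun p hp hp' => (h₁.nonempty ht hp).ne_empty
    (disjoint_self.1 (hd.mono (hZ₁ p hp) (hZ₂ p hp')))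
  have hnot : ∀ x ∈ Z₂, x ∉ Z₁ := fun x hx hx' => disjoint_left.1 hd hx' hx
  have hmem : ∀ u ∈ O ∩ (Z₁ ∪ Z₂), (u ∈ X ∨ β u ∈ s₁ ∪ s₂) →
      (u ∈ Z₁ ∧ u ∈ O ∩ Z₁ ∧ (u ∈ X ∨ β u ∈ s₁)) ∨
      (u ∉ Z₁ ∧ u ∈ O ∩ Z₂ ∧ (u ∈ X ∨ β u ∈ s₂)) := by
    intro u hu hu'
    obtain ⟨huO, hu⟩ := mem_inter.1 hu
    have hor : u ∈ X ∨ (u ∈ Z₁ ∧ β u ∈ s₁) ∨ (u ∈ Z₂ ∧ β u ∈ s₂) := by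
      by_cases huX : u ∈ X
      · exact Or.inl huX
      · have hβu := hβ u (mem_sdiff.2 ⟨huO, huX⟩)
        rcases mem_union.1 (hu'.resolve_left huX) with h | h
        · exact Or.inr (Or.inl ⟨hs₁ _ h hβu, h⟩)
        · exact Or.inr (Or.inr ⟨hs₂ _ h hβu, h⟩)
    have := hnot u
    simp only [mem_inter, mem_union] at *
    tauto
  suffices h : Packing X O A b β t τ (2 * t) (s₁ ∪ s₂) (Z₁ ∪ Z₂) (P₁ ∪ P₂) (q₁ ∪ q₂)
      fun u => if u ∈ Z₁ then g₁ u else g₂ u by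
    obtain ⟨P, q, h⟩ := h.normalize ht hτ
    exact ⟨P, q, _, h⟩
  constructor
  · rw [inter_union_distrib_left]
    exact union_subset_union h₁.rem_subset h₂.rem_subset
  · have := card_union_le q₁ q₂
    have := h₁.rem_card
    have := h₂.rem_card
    omega
  · rw [inter_union_distrib_left]
    intro p hp
    rcases mem_union.1 hp with hp | hp
    · exact (h₁.subset p hp).trans subset_union_left
    · exact (h₂.subset p hp).trans subset_union_right
  · intro p hp
    rcases mem_union.1 hp with hp | hp
    · exact h₁.block p hp
    · exact h₂.block p hp
  · intro p hp p' hp' hne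
    rcases mem_union.1 hp with hp | hp <;> rcases mem_union.1 hp' with hp' | hp'
    · exact h₁.disj p hp p' hp' hne
    · exact hd.mono (hZ₁ p hp) (hZ₂ p' hp')
    · exact (hd.mono (hZ₁ p' hp') (hZ₂ p hp)).symm
    · exact h₂.disj p hp p' hp' hne
  · intro p hp
    rw [disjoint_union_right]
    rcases mem_union.1 hp with hp | hp
    · exact ⟨h₁.rem_disj p hp, hd.mono (hZ₁ p hp) hq₂⟩
    · exact ⟨(hd.mono hq₁ (hZ₂ p hp)).symm, h₂.rem_disj p hp⟩
  · rw [inter_union_distrib_left, card_union_of_disjoint hP, card_union_of_disjoint,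
      card_union_of_disjoint (hd.mono hq₁ hq₂), mul_add]
    · have := h₁.card_le
      have := h₂.card_le
      omega
    · exact hd.mono inter_subset_right inter_subset_right
  · intro i hi
    rw [filter_union, union_inter_distrib_right]
    rcases mem_union.1 hi with hi | hi
    · have hP₂ : {p ∈ P₂ | (p ∩ A i).Nonempty} = ∅ := filter_eq_empty_iff.2 fun p hp => by
        rw [not_nonempty_iff_eq_empty, ← disjoint_iff_inter_eq_empty]
        exact (hd.mono (hs₁ i hi) (hZ₂ p hp)).symm
      have hq : q₂ ∩ A i = ∅ := disjoint_iff_inter_eq_empty.1 (hd.mono (hs₁ i hi) hq₂).symm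
      rw [hP₂, hq, union_empty, union_empty]
      exact h₁.meet_le i hi
    · have hP₁ : {p ∈ P₁ | (p ∩ A i).Nonempty} = ∅ := filter_eq_empty_iff.2 fun p hp => by
        rw [not_nonempty_iff_eq_empty, ← disjoint_iff_inter_eq_empty]
        exact hd.mono (hZ₁ p hp) (hs₂ i hi)
      have hq : q₁ ∩ A i = ∅ := disjoint_iff_inter_eq_empty.1 (hd.mono hq₁ (hs₂ i hi))
      rw [hP₁, hq, empty_union, empty_union]
      exact h₂.meet_le i hi
  · intro u hu hu'
    rcases hmem u hu hu' with ⟨hZ, h⟩ | ⟨hZ, h⟩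
    · simp only [hZ, if_true]
      exact mem_union_left _ (h₁.map_mem u h.1 h.2)
    · simp only [hZ, if_false]
      exact mem_union_right _ (h₂.map_mem u h.1 h.2)
  · rintro u ⟨hu, hu'⟩ v ⟨hv, hv'⟩ huv
    rcases hmem u hu hu' with ⟨hZ, h⟩ | ⟨hZ, h⟩ <;>
      rcases hmem v hv hv' with ⟨hZ', h'⟩ | ⟨hZ', h'⟩ <;>
      simp only [hZ, hZ', if_true, if_false] at huv
    · exact h₁.map_inj h h' huv
    · exact absurd (huv ▸ h₂.map_mem v h'.1 h'.2)
        (disjoint_left.1 hP (h₁.map_mem u h.1 h.2))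
    · exact absurd (huv ▸ h₂.map_mem u h.1 h.2)
        (disjoint_left.1 hP (h₁.map_mem v h'.1 h'.2))
    · exact h₂.map_inj h h' huv
  · intro u hu hu'
    rcases hmem u hu (Or.inl hu') with ⟨hZ, h⟩ | ⟨hZ, h⟩
    · simp only [hZ, if_true]
      exact h₁.map_self u h.1 hu'
    · simp only [hZ, if_false]
      exact h₂.map_self u h.1 hu'
  · intro u hu hu' hi
    rcases hmem u hu (Or.inr hi) with ⟨hZ, h⟩ | ⟨hZ, h⟩
    · simp only [hZ, if_true]
      exact h₁.map_subset u h.1 hu' (h.2.resolve_left hu')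
    · simp only [hZ, if_false]
      exact h₂.map_subset u h.1 hu' (h.2.resolve_left hu')

/-- With at least `b i` blocks, keep exactly `b i`, including those in use, and drop the remainder;
these suffice for the at most `b i` elements of `O ∩ A i`. With fewer blocks, `A i` cannot be tight,
so no new element needs a block, and the remainder still fits the bound. -/
theorem Packing.insert_index [DecidableEq ι] {i : ι} (h : Packing X O A b β t τ t s (A i) P q g) (ht : 0 < t)
    (hτ : 2 * t ≤ τ) (hX : #(X ∩ A i) ≤ τ * b i) (hO : #(O ∩ A i) ≤ b i)
    (hβ : ∀ u ∈ O \ X, u ∈ A (β u) ∧ τ * b (β u) ≤ #(X ∩ A (β u))) :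
    ∃ P q g, Packing X O A b β t τ t (insert i s) (A i) P q g := by
  by_cases hP : b i ≤ #P
  · set T := {u ∈ O ∩ A i | u ∈ X ∨ β u ∈ s} with hT
    set T' := {u ∈ O ∩ A i | u ∈ X ∨ β u ∈ insert i s} with hT'
    have hTi : Set.InjOn g ↑T := by
      rw [hT, coe_filter]
      exact h.map_inj
    have hTP : ∀ u ∈ T, g u ∈ P := fun u hu =>
      h.map_mem u (mem_filter.1 hu).1 (mem_filter.1 hu).2
    obtain ⟨P', hTP', hP'P, hP'⟩ := exists_subsuperset_card_eq (image_subset_iff.2 hTP)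
      ((card_image_le.trans (card_filter_le _ _)).trans hO) hP
    have hTT' : T ⊆ T' := monotone_filter_right _ fun u _ hu => hu.imp_right mem_insert_of_mem
    obtain ⟨g', hg', hg'P, hg'i⟩ := exists_injOn_extension (g := g) hTT'
      (by rw [hP']; exact (card_filter_le _ _).trans hO) (image_subset_iff.1 hTP') hTi
    refine ⟨P', ∅, g', { rem_subset := empty_subset _
                         rem_card := by simpa using ht
                         subset := fun p hp => h.subset p (hP'P hp)
                         block := fun p hp => h.block p (hP'P hp)
                         disj := fun p hp p' hp' => h.disj p (hP'P hp) p' (hP'P hp')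
                         rem_disj := by simp
                         card_le := by rw [hP']; simpa using hX
                         meet_le := ?_
                         map_mem := fun u hu hu' => hg'P u (mem_filter.2 ⟨hu, hu'⟩)
                         map_inj := ?_
                         map_self := ?_
                         map_subset := ?_ }⟩
    · intro j hj
      rw [empty_inter, if_neg Finset.not_nonempty_empty, add_zero]
      rcases mem_insert.1 hj with rfl | hj
      · exact (card_filter_le _ _).trans hP'.le
      · exact (card_le_card (filter_subset_filter _ hP'P)).trans
          ((Nat.le_add_right _ _).trans (h.meet_le j hj))
    · rw [hT', coe_filter] at hg'i
      exact hg'i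
    · intro u hu huX
      rw [hg' u (mem_filter.2 ⟨hu, Or.inl huX⟩)]
      exact h.map_self u hu huX
    · intro u hu huX hi
      by_cases hs : β u ∈ s
      · rw [hg' u (mem_filter.2 ⟨hu, Or.inr hs⟩)]
        exact h.map_subset u hu huX hs
      · have hui : β u = i := (mem_insert.1 hi).resolve_right hs
        rw [hui]
        exact (h.subset _ (hP'P (hg'P u (mem_filter.2 ⟨hu, Or.inr hi⟩)))).trans
          inter_subset_right
  · push Not at hP
    have hcard := h.card_le
    have hrem := h.rem_card
    have hi : ∀ u ∈ O ∩ A i, u ∉ X → β u ∈ insert i s → β u ∈ s := by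
      intro u hu huX hs
      refine (mem_insert.1 hs).resolve_left fun hui => ?_
      have h₁ := (hβ u (mem_sdiff.2 ⟨(mem_inter.1 hu).1, huX⟩)).2
      -- Tightness would force `τ * (#P + 1) ≤ τ * #P + #q`, impossible as `#q < t ≤ τ`.
      have h₂ : τ * (#P + 1) ≤ τ * b i := Nat.mul_le_mul_left τ hP
      rw [hui] at h₁
      rw [mul_add] at h₂
      omega
    have hi' : ∀ u ∈ O ∩ A i, u ∈ X ∨ β u ∈ insert i s → u ∈ X ∨ β u ∈ s := by
      intro u hu hs
      by_cases huX : u ∈ X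
      · exact Or.inl huX
      · exact Or.inr (hi u hu huX (hs.resolve_left huX))
    refine ⟨P, q, g, { h with
      meet_le := ?_
      map_mem := fun u hu hu' => h.map_mem u hu (hi' u hu hu')
      map_inj := h.map_inj.mono fun u (hu : _ ∧ _) => And.intro hu.1 (hi' u hu.1 hu.2)
      map_subset := fun u hu hu' hs => h.map_subset u hu hu' (hi u hu hu' hs) }⟩
    intro j hj
    rcases mem_insert.1 hj with rfl | hj
    · have := card_filter_le P fun p => (p ∩ A j).Nonempty
      split_ifs <;> omega
    · exact h.meet_le j hj

/-- In a laminar family with bounds `b`, let `X` meet every member `A i` in at most `τ * b i`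
elements, with equality for the member `A (β u)` chosen for `u ∈ O \ X`. Then disjoint blocks of
`t` elements of `X \ O` can be chosen in the sets `A (β u)` so that together with `O ∩ X` they
respect the bounds. -/
theorem exists_laminar_blocks [Fintype ι]
    (hA : ∀ i j, Disjoint (A i) (A j) ∨ A i ⊆ A j ∨ A j ⊆ A i) (ht : 0 < t)
    (hτ : 2 * t ≤ τ) (hX : ∀ i, #(X ∩ A i) ≤ τ * b i) (hO : ∀ i, #(O ∩ A i) ≤ b i)
    (hβ : ∀ u ∈ O \ X, u ∈ A (β u) ∧ τ * b (β u) ≤ #(X ∩ A (β u))) :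
    ∃ U : α → Finset α, (∀ u ∈ O \ X, U u ⊆ (X \ O) ∩ A (β u) ∧ #(U u) = t) ∧
      (∀ u ∈ O \ X, ∀ v ∈ O \ X, u ≠ v → Disjoint (U u) (U v)) ∧
      ∀ i, #{y ∈ X ∩ O | y ∈ A i} + #{u ∈ O \ X | (U u ∩ A i).Nonempty} ≤ b i := by
  classical
  set Z := X ∪ O ∪ univ.biUnion A
  obtain ⟨P, q, g, h⟩ : ∃ P q g, Packing X O A b β t τ t univ Z P q g :=
    laminar_induction A hA (C := fun s Z => ∃ P q g, Packing X O A b β t τ t s Z P q g)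
      (Packing.exists_empty ht) (Packing.exists_singleton ht hτ)
      (fun s₁ s₂ Z₁ Z₂ hd hs₁ hs₂ ⟨P₁, q₁, g₁, h₁⟩ ⟨P₂, q₂, g₂, h₂⟩ =>
        h₁.union h₂ ht hτ (fun u hu => (hβ u hu).1) hd hs₁ hs₂)
      (fun s i _ ⟨P, q, g, h⟩ => h.insert_index ht hτ (hX i) (hO i) hβ) univ Z
      fun i _ => (subset_biUnion_of_mem A (mem_univ i)).trans subset_union_right
  have hOZ : ∀ u ∈ O, u ∈ O ∩ Z := fun u hu =>
    mem_inter.2 ⟨hu, mem_union_left _ (mem_union_right _ hu)⟩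
  have hgP : ∀ u ∈ O, g u ∈ P := fun u hu => h.map_mem u (hOZ u hu) (Or.inr (mem_univ _))
  have hinj : ∀ u ∈ O, ∀ v ∈ O, g u = g v → u = v := fun u hu v hv huv =>
    h.map_inj ⟨hOZ u hu, Or.inr (mem_univ _)⟩ ⟨hOZ v hv, Or.inr (mem_univ _)⟩ huv
  have hblock : ∀ u ∈ O \ X, g u ⊆ X \ O ∧ t ≤ #(g u) := by
    intro u hu
    obtain ⟨hu, huX⟩ := mem_sdiff.1 hu
    -- A singleton block `{y}` with `y ∈ O` is already taken by `y` itself.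
    refine (h.block _ (hgP u hu)).resolve_left ?_
    rintro ⟨y, hy, hyu⟩
    have hyX : y ∈ X := (mem_inter.1 (h.subset _ (hgP u hu) (hyu ▸ mem_singleton_self y))).1
    rw [← h.map_self y (hOZ y hy) hyX] at hyu
    exact huX (hinj u hu y hy hyu ▸ hyX)
  have hex : ∀ u, ∃ U : Finset α, u ∈ O \ X → U ⊆ g u ∧ #U = t := by
    intro u
    by_cases hu : u ∈ O \ X
    · obtain ⟨U, hU⟩ := exists_subset_card_eq (hblock u hu).2
      exact ⟨U, fun _ => hU⟩
    · exact ⟨∅, fun h => absurd h hu⟩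
  choose U hU using hex
  refine ⟨U, fun u hu => ⟨subset_inter ((hU u hu).1.trans (hblock u hu).1) ?_, (hU u hu).2⟩,
    fun u hu v hv huv => ?_, fun i => ?_⟩
  · exact (hU u hu).1.trans (h.map_subset u (hOZ u (mem_sdiff.1 hu).1) (mem_sdiff.1 hu).2
      (mem_univ _))
  · have hu' := (mem_sdiff.1 hu).1
    have hv' := (mem_sdiff.1 hv).1
    exact (h.disj _ (hgP u hu') _ (hgP v hv') fun h => huv (hinj u hu' v hv' h)).mono
      (hU u hu).1 (hU v hv).1
  · refine le_trans ?_ ((Nat.le_add_right _ _).trans (h.meet_le i (mem_univ i)))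
    rw [← card_union_of_disjoint]
    · refine card_le_card_of_injOn g ?_ ?_
      · intro u hu
        rw [coe_filter]
        rcases mem_union.1 (mem_coe.1 hu) with hu | hu
        · obtain ⟨hu, hi⟩ := mem_filter.1 hu
          obtain ⟨huX, huO⟩ := mem_inter.1 hu
          refine ⟨hgP u huO, u, ?_⟩
          rw [h.map_self u (hOZ u huO) huX]
          simpa using hi
        · obtain ⟨hu, hi⟩ := mem_filter.1 hu
          exact ⟨hgP u (mem_sdiff.1 hu).1, hi.mono (inter_subset_inter_right (hU u hu).1)⟩
      · have hsub : ∀ u ∈ {y ∈ X ∩ O | y ∈ A i} ∪ {u ∈ O \ X | (U u ∩ A i).Nonempty}, u ∈ O := by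
          intro u hu
          simp only [mem_union, mem_filter, mem_inter, mem_sdiff] at hu
          tauto
        exact fun u hu v hv => hinj u (hsub u hu) v (hsub v hv)
    · refine disjoint_left.2 fun u hu hu' => ?_
      exact (mem_sdiff.1 (mem_filter.1 hu').1).2 (mem_inter.1 (mem_filter.1 hu).1).1

end Packing

/-! ### The greedy procedure -/

section Greedy

variable {α : Type*} {M : Matroid α} {ω : α → ℝ} {τ t : ℕ}

theorem UnionIndep.subset_ground {S : Set α} (h : UnionIndep M τ S) : S ⊆ M.E := by
  obtain ⟨P, hP, -, rfl⟩ := h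
  exact Set.iUnion_subset fun i => (hP i).subset_ground

theorem unionIndep_empty : UnionIndep M τ ∅ :=
  ⟨fun _ => ∅, fun _ => M.empty_indep, fun _ _ _ => Set.disjoint_empty _, by simp⟩

theorem subset_greedyStep (S : Set α) (u : α) : S ⊆ greedyStep M τ S u := by
  unfold greedyStep
  split_ifs
  · exact Set.subset_insert u S
  · exact subset_rfl

theorem greedyStep_subset (S : Set α) (u : α) : greedyStep M τ S u ⊆ insert u S := by
  unfold greedyStep
  split_ifs
  · exact subset_rfl
  · exact Set.subset_insert u S

theorem UnionIndep.greedyStep {S : Set α} (h : UnionIndep M τ S) (u : α) :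
    UnionIndep M τ (greedyStep M τ S u) := by
  unfold GreedyUnion.greedyStep
  split_ifs with hu
  · exact hu
  · exact h

theorem subset_foldl_greedyStep (l : List α) (S : Set α) : S ⊆ l.foldl (greedyStep M τ) S := by
  induction l generalizing S with
  | nil => exact subset_rfl
  | cons u l ih => exact (subset_greedyStep S u).trans (ih _)

theorem foldl_greedyStep_subset (l : List α) (S : Set α) :
    l.foldl (greedyStep M τ) S ⊆ S ∪ {x | x ∈ l} := by
  induction l generalizing S with
  | nil => exact Set.subset_union_left
  | cons u l ih =>
    intro x hx
    rcases ih _ hx with hx | hx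
    · rcases greedyStep_subset S u hx with rfl | hx
      · exact Or.inr List.mem_cons_self
      · exact Or.inl hx
    · exact Or.inr (List.mem_cons_of_mem u hx)

theorem unionIndep_foldl_greedyStep (l : List α) {S : Set α} (h : UnionIndep M τ S) :
    UnionIndep M τ (l.foldl (greedyStep M τ) S) := by
  induction l generalizing S with
  | nil => exact h
  | cons u l ih => exact ih (h.greedyStep u)

theorem unionIndep_greedy (l : List α) : UnionIndep M τ (greedy M τ l) :=
  unionIndep_foldl_greedyStep l unionIndep_empty

/-- An element is rejected by the greedy procedure because of a set of chosen elements, each at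
least as heavy. -/
theorem exists_of_notMem_greedy {l : List α} (hl : IsGreedyOrder M ω l) {u : α} (hu : u ∈ M.E)
    (hul : u ∉ greedy M τ l) :
    ∃ G ⊆ greedy M τ l, (∀ v ∈ G, ω u ≤ ω v) ∧ ¬ UnionIndep M τ (insert u G) := by
  -- The obstructing set is the greedy set just before `u` is processed.
  obtain ⟨l₁, l₂, rfl⟩ := List.append_of_mem ((hl.2.1 u).2 hu)
  have hgreedy : greedy M τ (l₁ ++ u :: l₂) =
      l₂.foldl (greedyStep M τ) (greedyStep M τ (greedy M τ l₁) u) := by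
    simp [greedy, List.foldl_append]
  rw [hgreedy] at hul ⊢
  refine ⟨greedy M τ l₁, (subset_greedyStep _ u).trans (subset_foldl_greedyStep _ _), ?_, ?_⟩
  · intro v hv
    have hv₁ : v ∈ l₁ := by simpa using foldl_greedyStep_subset l₁ ∅ hv
    exact (List.pairwise_append.1 hl.2.2).2.2 v hv₁ u List.mem_cons_self
  · intro h
    apply hul
    apply subset_foldl_greedyStep
    rw [greedyStep, if_pos h]
    exact Set.mem_insert u _

theorem isBase_inter_union_image_of_subset {O X : Set α} (hO : M.IsBase O) (h : O \ X = ∅)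
    (f : α → α) : M.IsBase ((X ∩ O) ∪ f '' (O \ X)) := by
  rwa [h, Set.image_empty, Set.union_empty, Set.inter_eq_right.2 (Set.sdiff_eq_empty.1 h)]

theorem isRobust_zero {X : Set α} (hX : X ⊆ M.E) : IsRobust M ω 0 X :=
  ⟨hX, fun O hO => ⟨fun _ => ∅, by simp, by simp, by simp, by simp, fun f hf =>
    isBase_inter_union_image_of_subset hO
      (Set.eq_empty_of_forall_notMem fun u hu => hf u hu) f⟩⟩

/-- Replacing the elements of a base outside `X` by distinct elements of `X` yields a base as soon
as the result is independent. -/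
theorem isBase_exchange [M.Finite] {O X : Set α} (hO : M.IsBase O) {f : α → α}
    (hf : ∀ u ∈ O \ X, f u ∈ X \ O) (hinj : Set.InjOn f (O \ X))
    (h : M.Indep ((X ∩ O) ∪ f '' (O \ X))) : M.IsBase ((X ∩ O) ∪ f '' (O \ X)) := by
  refine h.isBase_of_eRk_ge (M.ground_finite.subset h.subset_ground) ?_
  rw [h.eRk_eq_encard, Set.encard_union_eq, hinj.encard_image, ← hO.encard_eq_eRank,
    ← Set.encard_sdiff_add_encard_inter O X, add_comm, Set.inter_comm]
  rw [Set.disjoint_left]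
  rintro _ hx ⟨u, hu, rfl⟩
  exact (hf u hu).2 hx.2

/-- Robustness may be checked on finite sets, and it suffices to check independence. -/
theorem isRobust_of_finset [DecidableEq α] [M.Finite] {X : Finset α} (hX : (X : Set α) ⊆ M.E)
    (h : ∀ O : Finset α, M.IsBase ↑O → (O \ X).Nonempty → ∃ U : α → Finset α,
      (∀ u ∈ O \ X, U u ⊆ X \ O ∧ #(U u) = t ∧ ∀ v ∈ U u, ω u ≤ ω v) ∧
      (∀ u ∈ O \ X, ∀ v ∈ O \ X, u ≠ v → Disjoint (U u) (U v)) ∧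
      ∀ f : α → α, (∀ u ∈ O \ X, f u ∈ U u) → M.Indep ↑((X ∩ O) ∪ (O \ X).image f)) :
    IsRobust M ω t ↑X := by
  refine ⟨hX, fun O hO => ?_⟩
  lift O to Finset α using M.ground_finite.subset hO.subset_ground
  rcases (O \ X).eq_empty_or_nonempty with hempty | hne
  · have hempty' : (↑O \ ↑X : Set α) = ∅ := by exact_mod_cast hempty
    exact ⟨fun _ => ∅, by simp, by simp, by simp [hempty'], by simp, fun f _ =>
      isBase_inter_union_image_of_subset hO hempty' f⟩
  obtain ⟨U, hU, hd, hind⟩ := h O hO hne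
  have hmem : ∀ u : α, u ∈ (↑O \ ↑X : Set α) ↔ u ∈ O \ X := by simp
  refine ⟨fun u => ↑(U u), fun u hu => ?_, fun u hu v hv huv => ?_, fun u hu => ?_,
    fun u hu => ?_, fun f hf => isBase_exchange hO ?_ ?_ ?_⟩
  · rw [hmem] at hu
    exact_mod_cast (hU u hu).1
  · rw [hmem] at hu hv
    exact disjoint_coe.2 (hd u hu v hv huv)
  · rw [hmem] at hu
    rw [Set.encard_coe_eq_coe_finsetCard, (hU u hu).2.1]
  · rw [hmem] at hu
    exact (hU u hu).2.2
  · intro u hu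
    have := (hU u ((hmem u).1 hu)).1 (hf u hu)
    simpa using this
  · intro u hu v hv huv
    by_contra hne
    exact disjoint_left.1 (hd u ((hmem u).1 hu) v ((hmem v).1 hv) hne) (hf u hu)
      (huv ▸ hf v hv)
  · exact_mod_cast hind f fun u hu => hf u ((hmem u).2 hu)

end Greedy

/-! ### Partition and laminar matroids -/

section LaminarMatroid

variable {α : Type*} [DecidableEq α] {M : Matroid α} {ω : α → ℝ} {τ t r : ℕ}
  {A : Fin r → Finset α} {b : Fin r → ℕ}

theorem UnionIndep.card_inter_le
    (hM : ∀ S : Finset α, M.Indep ↑S ↔ ↑S ⊆ M.E ∧ ∀ i, #(S ∩ A i) ≤ b i) {S : Finset α}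
    (h : UnionIndep M τ ↑S) (i : Fin r) : #(S ∩ A i) ≤ τ * b i := by
  obtain ⟨P, hP, -, hPS⟩ := h
  have hfin : ∀ k, (P k).Finite := fun k =>
    S.finite_toSet.subset (hPS ▸ Set.subset_iUnion P k)
  lift P to Fin τ → Finset α using hfin
  have hS : S ∩ A i = univ.biUnion fun k => P k ∩ A i := by
    ext x
    have : x ∈ S ↔ ∃ k, x ∈ P k := by rw [← mem_coe, ← hPS]; simp
    simp [this]
  calc #(S ∩ A i) ≤ ∑ k, #(P k ∩ A i) := hS ▸ card_biUnion_le
    _ ≤ ∑ _k : Fin τ, b i := sum_le_sum fun k _ => ((hM _).1 (hP k)).2 i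
    _ = τ * b i := by simp

theorem unionIndep_of_card_inter_le
    (hA : ∀ i j, Disjoint (A i) (A j) ∨ A i ⊆ A j ∨ A j ⊆ A i)
    (hM : ∀ S : Finset α, M.Indep ↑S ↔ ↑S ⊆ M.E ∧ ∀ i, #(S ∩ A i) ≤ b i) {S : Finset α}
    (hS : (S : Set α) ⊆ M.E) (hτ : 0 < τ) (h : ∀ i, #(S ∩ A i) ≤ τ * b i) :
    UnionIndep M τ ↑S := by
  obtain ⟨c, hc⟩ := exists_laminar_coloring A hA S hτ b h
  refine ⟨fun k => ↑{x ∈ S | c x = k}, fun k => (hM _).2 ⟨?_, fun i => ?_⟩, ?_, ?_⟩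
  · exact (coe_subset.2 (filter_subset _ S)).trans hS
  · rw [filter_inter]
    exact hc i k
  · intro k k' hkk'
    rw [disjoint_coe, disjoint_left]
    intro x hx hx'
    exact hkk' ((mem_filter.1 hx).2.symm.trans (mem_filter.1 hx').2)
  · ext x
    simp

/-- The bound violated by `insert u G` must involve `u`, as `X` itself satisfies it. So `G` already
fills that member, which leaves no room for later elements: `X` and `G` agree there, and all of `X`
in it is heavy. -/
theorem exists_tight_of_notMem_greedy
    (hA : ∀ i j, Disjoint (A i) (A j) ∨ A i ⊆ A j ∨ A j ⊆ A i)
    (hM : ∀ S : Finset α, M.Indep ↑S ↔ ↑S ⊆ M.E ∧ ∀ i, #(S ∩ A i) ≤ b i) (hτ : 0 < τ)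
    {l : List α} (hl : IsGreedyOrder M ω l) {X : Finset α} (hX : ↑X = greedy M τ l) {u : α}
    (hu : u ∈ M.E) (huX : u ∉ X) :
    ∃ i, u ∈ A i ∧ τ * b i ≤ #(X ∩ A i) ∧ ∀ v ∈ X ∩ A i, ω u ≤ ω v := by
  have hXi : UnionIndep M τ ↑X := hX ▸ unionIndep_greedy l
  obtain ⟨G, hGX, hGω, hG⟩ := exists_of_notMem_greedy hl hu (by rwa [← hX])
  rw [← hX] at hGX
  lift G to Finset α using X.finite_toSet.subset hGX
  rw [coe_subset] at hGX
  rw [← coe_insert] at hG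
  have hE : (↑(insert u G) : Set α) ⊆ M.E := by
    rw [coe_insert]
    exact Set.insert_subset hu ((coe_subset.2 hGX).trans hXi.subset_ground)
  obtain ⟨i, hi⟩ : ∃ i, τ * b i < #(insert u G ∩ A i) := by
    by_contra! h
    exact hG (unionIndep_of_card_inter_le hA hM hE hτ h)
  have hle := hXi.card_inter_le hM i
  have hGi : #(G ∩ A i) ≤ #(X ∩ A i) := card_le_card (inter_subset_inter_right hGX)
  by_cases hui : u ∈ A i
  · rw [insert_inter_of_mem hui] at hi
    have := card_insert_le u (G ∩ A i)
    have heq : G ∩ A i = X ∩ A i :=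
      eq_of_subset_of_card_le (inter_subset_inter_right hGX) (by omega)
    refine ⟨i, hui, by omega, fun v hv => ?_⟩
    rw [← heq] at hv
    exact hGω v (mem_inter.1 hv).1
  · rw [insert_inter_of_notMem hui] at hi
    omega

/-- A choice function puts into `A i` at most one element per block meeting `A i`, so counting
blocks controls all choices at once. -/
theorem indep_of_blocks
    (hM : ∀ S : Finset α, M.Indep ↑S ↔ ↑S ⊆ M.E ∧ ∀ i, #(S ∩ A i) ≤ b i) {X O : Finset α}
    (hX : (X : Set α) ⊆ M.E) {U : α → Finset α} (hU : ∀ u ∈ O \ X, U u ⊆ X)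
    (hb : ∀ i, #{y ∈ X ∩ O | y ∈ A i} + #{u ∈ O \ X | (U u ∩ A i).Nonempty} ≤ b i) {f : α → α}
    (hf : ∀ u ∈ O \ X, f u ∈ U u) : M.Indep ↑((X ∩ O) ∪ (O \ X).image f) := by
  refine (hM _).2 ⟨?_, fun i => le_trans ?_ (hb i)⟩
  · refine (coe_subset.2 (union_subset inter_subset_left ?_)).trans hX
    exact image_subset_iff.2 fun u hu => hU u hu (hf u hu)
  · have hsub : ((X ∩ O) ∪ (O \ X).image f) ∩ A i ⊆
        {y ∈ X ∩ O | y ∈ A i} ∪ {u ∈ O \ X | (U u ∩ A i).Nonempty}.image f := by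
      intro x hx
      obtain ⟨hx, hxi⟩ := mem_inter.1 hx
      rcases mem_union.1 hx with hx | hx
      · exact mem_union_left _ (mem_filter.2 ⟨hx, hxi⟩)
      · obtain ⟨u, hu, rfl⟩ := mem_image.1 hx
        exact mem_union_right _ (mem_image_of_mem f
          (mem_filter.2 ⟨hu, f u, mem_inter.2 ⟨hf u hu, hxi⟩⟩))
    exact (card_le_card hsub).trans ((card_union_le _ _).trans
      (Nat.add_le_add_left card_image_le _))

theorem isRobust_of_laminar [M.Finite]
    (hA : ∀ i j, Disjoint (A i) (A j) ∨ A i ⊆ A j ∨ A j ⊆ A i)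
    (hM : ∀ S : Finset α, M.Indep ↑S ↔ ↑S ⊆ M.E ∧ ∀ i, #(S ∩ A i) ≤ b i) (ht : 0 < t)
    (hτ : 2 * t ≤ τ) {l : List α} (hl : IsGreedyOrder M ω l) {X : Finset α}
    (hX : ↑X = greedy M τ l) : IsRobust M ω t ↑X := by
  have hXi : UnionIndep M τ ↑X := hX ▸ unionIndep_greedy l
  refine isRobust_of_finset hXi.subset_ground fun O hO hne => ?_
  have htight : ∀ u ∈ O \ X, ∃ i,
      u ∈ A i ∧ τ * b i ≤ #(X ∩ A i) ∧ ∀ v ∈ X ∩ A i, ω u ≤ ω v := fun u hu =>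
    exists_tight_of_notMem_greedy hA hM (by omega) hl hX
      (hO.subset_ground (mem_sdiff.1 hu).1) (mem_sdiff.1 hu).2
  have : Nonempty (Fin r) := ⟨(htight _ hne.choose_spec).choose⟩
  choose! β hβ using htight
  obtain ⟨U, hU, hd, hb⟩ := exists_laminar_blocks hA ht hτ (fun i => hXi.card_inter_le hM i)
    ((hM O).1 hO.indep).2 fun u hu => ⟨(hβ u hu).1, (hβ u hu).2.1⟩
  refine ⟨U, fun u hu => ⟨(hU u hu).1.trans inter_subset_left, (hU u hu).2, fun v hv => ?_⟩, hd,
    fun f hf => indep_of_blocks hM hXi.subset_ground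
      (fun u hu => ((hU u hu).1.trans inter_subset_left).trans sdiff_subset) hb hf⟩
  obtain ⟨hv₁, hv₂⟩ := mem_inter.1 ((hU u hu).1 hv)
  exact (hβ u hu).2.2 v (mem_inter.2 ⟨(mem_sdiff.1 hv₁).1, hv₂⟩)

/-- A set with at least `t * #D` elements contains disjoint `t`-element sets indexed by `D`. -/
theorem exists_disjoint_subsets (t : ℕ) (D W : Finset α) (h : t * #D ≤ #W) :
    ∃ U : α → Finset α, (∀ u ∈ D, U u ⊆ W ∧ #(U u) = t) ∧
      ∀ u ∈ D, ∀ v ∈ D, u ≠ v → Disjoint (U u) (U v) := by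
  induction D using Finset.induction_on generalizing W with
  | empty => exact ⟨fun _ => ∅, by simp, by simp⟩
  | insert x D hx ih =>
    rw [card_insert_of_notMem hx, mul_add, mul_one] at h
    obtain ⟨U₀, hU₀, hcard⟩ := exists_subset_card_eq (show t ≤ #W by omega)
    obtain ⟨U, hU, hd⟩ := ih (W \ U₀) (by rw [card_sdiff_of_subset hU₀]; omega)
    have hne : ∀ u ∈ D, Function.update U x U₀ u = U u := fun u hu =>
      Function.update_of_ne (ne_of_mem_of_not_mem hu hx) _ _
    have hdx : ∀ u ∈ D, Disjoint U₀ (U u) := fun u hu =>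
      disjoint_sdiff.mono_right (hU u hu).1
    refine ⟨Function.update U x U₀, fun u hu => ?_, fun u hu v hv huv => ?_⟩
    · rcases mem_insert.1 hu with rfl | hu
      · simpa using ⟨hU₀, hcard⟩
      · rw [hne u hu]
        exact ⟨(hU u hu).1.trans sdiff_subset, (hU u hu).2⟩
    · rcases mem_insert.1 hu with hux | hu' <;> rcases mem_insert.1 hv with hvx | hv'
      · exact absurd (hux.trans hvx.symm) huv
      · rw [hux, hne v hv', Function.update_self]
        exact hdx v hv'
      · rw [hvx, hne u hu', Function.update_self]
        exact (hdx u hu').symm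
      · rw [hne u hu', hne v hv']
        exact hd u hu' v hv' huv

theorem isRobust_of_partition [M.Finite] (hA : ∀ i j, i ≠ j → Disjoint (A i) (A j))
    (hM : ∀ S : Finset α, M.Indep ↑S ↔ ↑S ⊆ M.E ∧ ∀ i, #(S ∩ A i) ≤ b i) (ht : 0 < t)
    (hτ : t ≤ τ) {l : List α} (hl : IsGreedyOrder M ω l) {X : Finset α}
    (hX : ↑X = greedy M τ l) : IsRobust M ω t ↑X := by
  have hXi : UnionIndep M τ ↑X := hX ▸ unionIndep_greedy l
  have hA' : ∀ i j, Disjoint (A i) (A j) ∨ A i ⊆ A j ∨ A j ⊆ A i := by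
    intro i j
    by_cases hij : i = j
    · exact Or.inr (Or.inl (hij ▸ subset_rfl))
    · exact Or.inl (hA i j hij)
  refine isRobust_of_finset hXi.subset_ground fun O hO hne => ?_
  have htight : ∀ u ∈ O \ X, ∃ i,
      u ∈ A i ∧ τ * b i ≤ #(X ∩ A i) ∧ ∀ v ∈ X ∩ A i, ω u ≤ ω v := fun u hu =>
    exists_tight_of_notMem_greedy hA' hM (by omega) hl hX
      (hO.subset_ground (mem_sdiff.1 hu).1) (mem_sdiff.1 hu).2
  have : Nonempty (Fin r) := ⟨(htight _ hne.choose_spec).choose⟩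
  choose! β hβ using htight
  have hβi : ∀ u ∈ O \ X, ∀ i, u ∈ A i → β u = i := by
    intro u hu i hi
    by_contra hne
    exact disjoint_left.1 (hA _ _ hne) (hβ u hu).1 hi
  have hcard : ∀ i, #{y ∈ X ∩ O | y ∈ A i} + #{u ∈ O \ X | u ∈ A i} ≤ b i := by
    intro i
    refine le_trans (le_of_eq ?_) (((hM O).1 hO.indep).2 i)
    rw [← card_union_of_disjoint]
    · congr 1
      ext x
      simp only [mem_union, mem_filter, mem_inter, mem_sdiff]
      tauto
    · refine disjoint_left.2 fun u hu hu' => ?_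
      exact (mem_sdiff.1 (mem_filter.1 hu').1).2 (mem_inter.1 (mem_filter.1 hu).1).1
  have hW : ∀ i, t * #{u ∈ O \ X | u ∈ A i} ≤ #((X \ O) ∩ A i) := by
    intro i
    rcases ({u ∈ O \ X | u ∈ A i}).eq_empty_or_nonempty with h | ⟨u, hu⟩
    · simp [h]
    obtain ⟨hu, hui⟩ := mem_filter.1 hu
    have htight := (hβ u hu).2.1
    rw [hβi u hu i hui] at htight
    have hsplit : #(X ∩ A i) = #((X \ O) ∩ A i) + #{y ∈ X ∩ O | y ∈ A i} := by
      rw [← card_union_of_disjoint]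
      · congr 1
        ext x
        simp only [mem_union, mem_filter, mem_inter, mem_sdiff]
        tauto
      · refine disjoint_left.2 fun u hu hu' => ?_
        exact (mem_sdiff.1 (mem_inter.1 hu).1).2 (mem_inter.1 (mem_filter.1 hu').1).2
    -- With `c` elements of `O ∩ X` and `d` of `O \ X` in a tight class, at least `τ * (c + d) - c ≥
    -- τ * d ≥ t * d` elements of `X \ O` are there, because `τ ≥ 1`.
    have h₁ := Nat.mul_le_mul_left τ (hcard i)
    have h₂ := Nat.mul_le_mul_right #{u ∈ O \ X | u ∈ A i} hτ
    have h₃ := Nat.mul_le_mul_right #{y ∈ X ∩ O | y ∈ A i} (ht.trans_le hτ)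
    rw [mul_add] at h₁
    omega
  choose V hV hd using fun i => exists_disjoint_subsets t _ _ (hW i)
  have hU : ∀ u ∈ O \ X, V (β u) u ⊆ (X \ O) ∩ A (β u) ∧ #(V (β u) u) = t := fun u hu =>
    hV (β u) u (mem_filter.2 ⟨hu, (hβ u hu).1⟩)
  refine ⟨fun u => V (β u) u, fun u hu =>
    ⟨(hU u hu).1.trans inter_subset_left, (hU u hu).2, fun v hv => ?_⟩, fun u hu v hv huv => ?_,
    fun f hf => indep_of_blocks hM hXi.subset_ground
      (fun u hu => ((hU u hu).1.trans inter_subset_left).trans sdiff_subset)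
      (fun i => le_trans (Nat.add_le_add_left (card_le_card ?_) _) (hcard i)) hf⟩
  · obtain ⟨hv₁, hv₂⟩ := mem_inter.1 ((hU u hu).1 hv)
    exact (hβ u hu).2.2 v (mem_inter.2 ⟨(mem_sdiff.1 hv₁).1, hv₂⟩)
  · by_cases huv' : β u = β v
    · have hv' := (hβ v hv).1
      have := hd (β u) u (mem_filter.2 ⟨hu, (hβ u hu).1⟩) v
        (mem_filter.2 ⟨hv, huv' ▸ hv'⟩) huv
      simpa only [huv'] using this
    · exact (hA _ _ huv').mono ((hU u hu).1.trans inter_subset_right)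
        ((hU v hv).1.trans inter_subset_right)
  · intro u hu
    obtain ⟨hu, x, hx⟩ := mem_filter.1 hu
    obtain ⟨hx, hxi⟩ := mem_inter.1 hx
    have hβu : β u = i := by
      by_contra hne
      exact disjoint_left.1 (hA _ _ hne) (mem_inter.1 ((hU u hu).1 hx)).2 hxi
    exact mem_filter.2 ⟨hu, hβu ▸ (hβ u hu).1⟩

end LaminarMatroid

/-! ### Transversal matroids -/

section Transversal

variable {α : Type*} {M : Matroid α} {ω : α → ℝ} {τ t m : ℕ} {A : Fin m → Set α}

theorem unionIndep_of_injective
    (hM : ∀ S : Set α, M.Indep S ↔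
      S ⊆ M.E ∧ ∃ φ : S → Fin m, Function.Injective φ ∧ ∀ u : S, (u : α) ∈ A (φ u))
    {S : Set α} (hS : S ⊆ M.E) (ψ : S → Fin m × Fin τ) (hψ : Function.Injective ψ)
    (hψA : ∀ u : S, (u : α) ∈ A (ψ u).1) : UnionIndep M τ S := by
  refine ⟨fun k => {x | ∃ h : x ∈ S, (ψ ⟨x, h⟩).2 = k}, fun k => (hM _).2
    ⟨fun x hx => hS hx.1, fun x => (ψ ⟨x, x.2.1⟩).1, ?_, fun x => hψA ⟨x, x.2.1⟩⟩, ?_, ?_⟩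
  · rintro ⟨x, hx, hxk⟩ ⟨y, hy, hyk⟩ hxy
    have := hψ (Prod.ext hxy (hxk.trans hyk.symm))
    exact Subtype.ext (Subtype.mk.inj this)
  · intro k k' hkk'
    rw [Set.disjoint_left]
    rintro x ⟨_, hx⟩ ⟨_, hx'⟩
    exact hkk' (hx.symm.trans hx')
  · ext x
    simp

theorem UnionIndep.exists_injective
    (hM : ∀ S : Set α, M.Indep S ↔
      S ⊆ M.E ∧ ∃ φ : S → Fin m, Function.Injective φ ∧ ∀ u : S, (u : α) ∈ A (φ u))
    {S : Set α} (h : UnionIndep M τ S) :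
    ∃ ψ : S → Fin m × Fin τ, Function.Injective ψ ∧ ∀ u : S, (u : α) ∈ A (ψ u).1 := by
  obtain ⟨P, hP, -, rfl⟩ := h
  choose φ hφ hφA using fun k => ((hM _).1 (hP k)).2
  choose k hk using fun x : ↑(⋃ i, P i) => Set.mem_iUnion.1 x.2
  refine ⟨fun x => (φ (k x) ⟨x, hk x⟩, k x), fun x y hxy => ?_, fun x => hφA (k x) ⟨x, hk x⟩⟩
  obtain ⟨h₁, h₂⟩ := Prod.ext_iff.1 hxy
  have key : ∀ (i j : Fin τ) (hi : ↑x ∈ P i) (hj : ↑y ∈ P j), i = j →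
      φ i ⟨x, hi⟩ = φ j ⟨y, hj⟩ → (x : α) = y := by
    rintro i _ hi hj rfl h
    exact Subtype.mk.inj (hφ i h)
  exact Subtype.ext (key _ _ (hk x) (hk y) h₂ h₁)

/-- If `u` cannot be added to a set `G` in the union of copies of a transversal matroid, then
every assignment of `G` to slots takes all slots available to `u`. -/
theorem exists_mem_of_not_unionIndep_insert
    (hM : ∀ S : Set α, M.Indep S ↔
      S ⊆ M.E ∧ ∃ φ : S → Fin m, Function.Injective φ ∧ ∀ u : S, (u : α) ∈ A (φ u))
    {G : Set α} (hG : G ⊆ M.E) {u : α} (hu : u ∈ M.E)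
    (h : ¬ UnionIndep M τ (insert u G)) {Ψ : α → Fin m × Fin τ} (hΨ : Set.InjOn Ψ G)
    (hΨA : ∀ v ∈ G, v ∈ A (Ψ v).1) {p : Fin m × Fin τ} (hp : u ∈ A p.1) :
    ∃ v ∈ G, Ψ v = p := by
  classical
  let T : ↑(insert u G) → Finset (Fin m × Fin τ) := fun x => {p | (x : α) ∈ A p.1}
  have hT : ¬ ∃ ψ : ↑(insert u G) → Fin m × Fin τ, Function.Injective ψ ∧ ∀ x, ψ x ∈ T x := by
    rintro ⟨ψ, hψ, hψT⟩
    exact h (unionIndep_of_injective hM (Set.insert_subset hu hG) ψ hψ fun x => by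
      simpa [T] using hψT x)
  -- Take a Hall violator `s`. Without `u` it is matched by `Ψ` into the slots of `s`, which number
  -- fewer than `#s`; so `u ∈ s` and the matching uses every one of these slots.
  rw [← all_card_le_biUnion_card_iff_exists_injective] at hT
  push Not at hT
  obtain ⟨s, hs⟩ := hT
  let s' := s.filter fun x => x ≠ ⟨u, Set.mem_insert u G⟩
  have hmem : ∀ x ∈ s', (x : α) ∈ G := fun x hx => 
    x.2.resolve_left fun hxu => (mem_filter.1 hx).2 (Subtype.ext hxu)
  have himage : s'.image (fun x : ↑(insert u G) => Ψ x) ⊆ s.biUnion T := by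
    refine image_subset_iff.2 fun x hx => mem_biUnion.2 ⟨x, (mem_filter.1 hx).1, ?_⟩
    simpa [T] using hΨA x (hmem x hx)
  have hcard : #(s'.image fun x : ↑(insert u G) => Ψ x) = #s' := card_image_of_injOn fun x hx y hy hxy =>
    Subtype.ext (hΨ (hmem x hx) (hmem y hy) hxy)
  have hus : (⟨u, Set.mem_insert u G⟩ : ↑(insert u G)) ∈ s := by
    by_contra hus
    have hss' : s' = s := filter_true_of_mem fun x hx => ne_of_mem_of_not_mem hx hus
    have := card_le_card himage
    rw [hcard, hss'] at this
    omega
  have hs'card : #s ≤ #s' + 1 := by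
    have hsub : s ⊆ insert ⟨u, Set.mem_insert u G⟩ s' := by
      intro x hx
      by_cases hxu : x = ⟨u, Set.mem_insert u G⟩
      · exact mem_insert.2 (Or.inl hxu)
      · exact mem_insert_of_mem (mem_filter.2 ⟨hx, hxu⟩)
    exact (card_le_card hsub).trans (card_insert_le _ _)
  have heq := eq_of_subset_of_card_le himage (by omega)
  have hpmem : p ∈ s.biUnion T := mem_biUnion.2 ⟨_, hus, by simpa [T] using hp⟩
  rw [← heq] at hpmem
  obtain ⟨x, hx, hxp⟩ := mem_image.1 hpmem
  exact ⟨x, hmem x hx, hxp⟩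

theorem indep_of_injOn
    (hM : ∀ S : Set α, M.Indep S ↔
      S ⊆ M.E ∧ ∃ φ : S → Fin m, Function.Injective φ ∧ ∀ u : S, (u : α) ∈ A (φ u))
    {S : Set α} (hS : S ⊆ M.E) {φ : α → Fin m} (hφ : Set.InjOn φ S) (hφA : ∀ u ∈ S, u ∈ A (φ u)) :
    M.Indep S :=
  (hM S).2 ⟨hS, fun u => φ u, hφ.injective, fun u => hφA u u.2⟩

theorem exists_injOn_of_injective {β : Type*} [Nonempty β] {S : Set α} {B : β → Set α}
    (h : ∃ φ : S → β, Function.Injective φ ∧ ∀ u : S, (u : α) ∈ B (φ u)) :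
    ∃ φ : α → β, Set.InjOn φ S ∧ ∀ u ∈ S, u ∈ B (φ u) := by
  classical
  obtain ⟨φ, hφ, hφB⟩ := h
  have heq : ∀ u (hu : u ∈ S),
      (fun x => if hx : x ∈ S then φ ⟨x, hx⟩ else Classical.arbitrary β) u = φ ⟨u, hu⟩ :=
    fun u hu => dif_pos hu
  refine ⟨fun x => if hx : x ∈ S then φ ⟨x, hx⟩ else Classical.arbitrary β, ?_, ?_⟩
  · intro u hu v hv huv
    rw [heq u hu, heq v hv] at huv
    exact congrArg Subtype.val (hφ huv)
  · intro u hu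
    rw [heq u hu]
    exact hφB ⟨u, hu⟩

theorem isRobust_of_transversal [DecidableEq α] [M.Finite]
    (hM : ∀ S : Set α, M.Indep S ↔
      S ⊆ M.E ∧ ∃ φ : S → Fin m, Function.Injective φ ∧ ∀ u : S, (u : α) ∈ A (φ u))
    (ht : 0 < t) {k : ℕ} (hk : M.eRank = k) (hτ : t + k ≤ τ + 1) {l : List α}
    (hl : IsGreedyOrder M ω l) {X : Finset α} (hX : ↑X = greedy M τ l) :
    IsRobust M ω t ↑X := by
  have hXi : UnionIndep M τ ↑X := hX ▸ unionIndep_greedy l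
  refine isRobust_of_finset hXi.subset_ground fun O hO hne => ?_
  have hOk : #O = k := by
    have := hO.encard_eq_eRank
    rw [hk, Set.encard_coe_eq_coe_finsetCard] at this
    exact_mod_cast this
  obtain ⟨u₀, hu₀⟩ := hne
  have hkpos : 0 < k := hOk ▸ card_pos.2 ⟨u₀, (mem_sdiff.1 hu₀).1⟩
  have hφex := ((hM _).1 hO.indep).2
  have : Nonempty (Fin m) := ⟨hφex.choose ⟨u₀, (mem_sdiff.1 hu₀).1⟩⟩
  have : Nonempty (Fin τ) := ⟨⟨0, by omega⟩⟩
  obtain ⟨φ, hφ, hφA⟩ := exists_injOn_of_injective hφex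
  obtain ⟨Ψ, hΨ, hΨA⟩ := exists_injOn_of_injective (B := fun p : Fin m × Fin τ => A p.1)
    (hXi.exists_injective hM)
  have hslot : ∀ u ∈ O \ X, ∀ j : Fin τ, ∃ v ∈ X, ω u ≤ ω v ∧ Ψ v = (φ u, j) := by
    intro u hu j
    obtain ⟨huO, huX⟩ := mem_sdiff.1 hu
    have huE := hO.subset_ground huO
    obtain ⟨G, hGX, hGω, hG⟩ := exists_of_notMem_greedy hl huE (by rwa [← hX])
    rw [← hX] at hGX
    obtain ⟨v, hv, hvp⟩ := exists_mem_of_not_unionIndep_insert hM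
      (hGX.trans hXi.subset_ground) huE hG (hΨ.mono hGX) (fun v hv => hΨA v (hGX hv))
      (p := (φ u, j)) (hφA u huO)
    exact ⟨v, hGX hv, hGω v hv, hvp⟩
  have hex : ∀ u ∈ O \ X, ∃ U : Finset α, U ⊆ X \ O ∧ #U = t ∧
      ∀ v ∈ U, ω u ≤ ω v ∧ (Ψ v).1 = φ u := by
    intro u hu
    choose w hwX hww hwΨ using hslot u hu
    have hinj : Function.Injective w := fun i j hij => by
      have := hwΨ i
      rw [hij, hwΨ j] at this
      exact (Prod.ext_iff.1 this).2.symm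
    -- Since `u ∉ X`, at most `k - 1` of the `τ` occupants lie in `O`; this is where `τ ≥ t + k - 1`
    -- enters.
    have hle : t ≤ #(univ.image w \ O) := by
      have h₁ := card_sdiff_add_card_inter (univ.image w) O
      have h₂ : #(univ.image w ∩ O) ≤ #(O.erase u) := by
        refine card_le_card fun v hv => ?_
        obtain ⟨hv, hvO⟩ := mem_inter.1 hv
        obtain ⟨j, -, rfl⟩ := mem_image.1 hv
        exact mem_erase.2 ⟨ne_of_mem_of_not_mem (hwX j) (mem_sdiff.1 hu).2, hvO⟩
      rw [card_erase_of_mem (mem_sdiff.1 hu).1] at h₂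
      rw [card_image_of_injective _ hinj, card_univ, Fintype.card_fin] at h₁
      omega
    obtain ⟨U, hU, hUt⟩ := exists_subset_card_eq hle
    refine ⟨U, fun v hv => ?_, hUt, fun v hv => ?_⟩
    all_goals
      obtain ⟨hv, hvO⟩ := mem_sdiff.1 (hU hv)
      obtain ⟨j, -, rfl⟩ := mem_image.1 hv
    · exact mem_sdiff.2 ⟨hwX j, hvO⟩
    · exact ⟨hww j, by rw [hwΨ j]⟩
  choose! U hUX hUt hU using hex
  have hφeq : ∀ u ∈ O \ X, ∀ v ∈ O \ X, φ u = φ v → u = v := fun u hu v hv h =>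
    hφ (mem_sdiff.1 hu).1 (mem_sdiff.1 hv).1 h
  refine ⟨U, fun u hu => ⟨hUX u hu, hUt u hu, fun v hv => (hU u hu v hv).1⟩,
    fun u hu v hv huv => disjoint_left.2 fun x hx hx' => huv (hφeq u hu v hv
      ((hU u hu x hx).2.symm.trans (hU v hv x hx').2)), fun f hf => ?_⟩
  have hfX : ∀ u ∈ O \ X, f u ∈ X ∧ f u ∉ O := fun u hu => mem_sdiff.1 (hUX u hu (hf u hu))
  have hχ : ∀ u ∈ O \ X, (if f u ∈ O then φ (f u) else (Ψ (f u)).1) = φ u := fun u hu => by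
    rw [if_neg (hfX u hu).2, (hU u hu _ (hf u hu)).2]
  have hcases : ∀ x ∈ (↑((X ∩ O) ∪ (O \ X).image f) : Set α),
      (x ∈ X ∧ x ∈ O) ∨ ∃ u ∈ O \ X, f u = x := fun x hx => by
    rcases mem_union.1 (mem_coe.1 hx) with hx | hx
    · exact Or.inl (mem_inter.1 hx)
    · exact Or.inr (mem_image.1 hx)
  -- Retained elements keep their index from `O`, and each replacement `f u` inherits `φ u`, so
  -- injectivity comes from `φ` on `O`.
  refine indep_of_injOn hM (φ := fun x => if x ∈ O then φ x else (Ψ x).1) ?_ ?_ ?_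
  · intro x hx
    rcases hcases x hx with ⟨hx, -⟩ | ⟨u, hu, rfl⟩
    · exact hXi.subset_ground hx
    · exact hXi.subset_ground (hfX u hu).1
  · intro x hx y hy hxy
    simp only at hxy
    rcases hcases x hx with ⟨hxX, hxO⟩ | ⟨u, hu, rfl⟩ <;>
      rcases hcases y hy with ⟨hyX, hyO⟩ | ⟨v, hv, rfl⟩
    · rw [if_pos hxO, if_pos hyO] at hxy
      exact hφ hxO hyO hxy
    · rw [if_pos hxO, hχ v hv] at hxy
      exact absurd (hφ hxO (mem_sdiff.1 hv).1 hxy ▸ hxX) (mem_sdiff.1 hv).2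
    · rw [if_pos hyO, hχ u hu] at hxy
      exact absurd (hφ hyO (mem_sdiff.1 hu).1 hxy.symm ▸ hyX) (mem_sdiff.1 hu).2
    · rw [hχ u hu, hχ v hv] at hxy
      rw [hφeq u hu v hv hxy]
  · intro x hx
    rcases hcases x hx with ⟨-, hx⟩ | ⟨u, hu, rfl⟩
    · simp only [hx, if_true]
      exact hφA x hx
    · simp only [(hfX u hu).2, if_false]
      exact hΨA _ (hfX u hu).1

end Transversal

/-! ### Passage to finite sets and the three classes of matroids -/

theorem indep_coe_iff {α : Type*} [DecidableEq α] {M : Matroid α} {r : ℕ} {A : Fin r → Finset α}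
    {b : Fin r → ℕ}
    (hM : ∀ S : Set α, M.Indep S ↔ S ⊆ M.E ∧ ∀ i, (S ∩ ↑(A i)).encard ≤ b i) (S : Finset α) :
    M.Indep ↑S ↔ ↑S ⊆ M.E ∧ ∀ i, #(S ∩ A i) ≤ b i := by
  simp only [hM, ← coe_inter, Set.encard_coe_eq_coe_finsetCard, Nat.cast_le]

end GreedyUnion

theorem mainTheorem2 {α : Type*} (M : Matroid α) [M.Finite] (ω : α → ℝ)
    (k : ℕ) (hk : M.eRank = k) (t τ : ℕ)
    (l : List α) (hl : GreedyUnion.IsGreedyOrder M ω l) :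
    (GreedyUnion.IsPartitionMatroid M → t ≤ τ →
      GreedyUnion.IsRobust M ω t (GreedyUnion.greedy M τ l)) ∧
    (GreedyUnion.IsLaminarMatroid M → 2 * t ≤ τ →
      GreedyUnion.IsRobust M ω t (GreedyUnion.greedy M τ l)) ∧
    (GreedyUnion.IsTransversalMatroid M → (t : ℤ) + (k : ℤ) - 1 ≤ (τ : ℤ) →
      GreedyUnion.IsRobust M ω t (GreedyUnion.greedy M τ l)) := by
  classical
  have hE := (GreedyUnion.unionIndep_greedy (M := M) (τ := τ) l).subset_ground
  -- For `t = 0` all `U u` are empty, so a choice exists only when `O` lies in the greedy set. This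
  -- case also covers `τ = 0` in the first two classes.
  rcases Nat.eq_zero_or_pos t with rfl | ht
  · exact ⟨fun _ _ => GreedyUnion.isRobust_zero hE, fun _ _ => GreedyUnion.isRobust_zero hE,
      fun _ _ => GreedyUnion.isRobust_zero hE⟩
  obtain ⟨X, hX⟩ := (M.ground_finite.subset hE).exists_finset_coe
  rw [← hX]
  refine ⟨?_, ?_, ?_⟩
  · rintro ⟨r, A, b, hA, hAE, hM⟩ hτ
    have hfin : ∀ i, (A i).Finite := fun i =>
      M.ground_finite.subset (hAE ▸ Set.subset_iUnion A i)
    lift A to Fin r → Finset α using hfin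
    exact GreedyUnion.isRobust_of_partition (fun i j hij => Finset.disjoint_coe.1 (hA i j hij))
      (GreedyUnion.indep_coe_iff hM) ht hτ hl hX
  · rintro ⟨r, A, b, hAE, hA, hM⟩ hτ
    have hfin : ∀ i, (A i).Finite := fun i => M.ground_finite.subset (hAE i)
    lift A to Fin r → Finset α using hfin
    exact GreedyUnion.isRobust_of_laminar (fun i j => by simpa using hA i j)
      (GreedyUnion.indep_coe_iff hM) ht hτ hl hX
  · rintro ⟨m, A, -, hM⟩ hτ
    exact GreedyUnion.isRobust_of_transversal hM ht hk (by omega) hl hX
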